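/- **Theorem 5.1.** Let $k,m,n$ be positive integers with $k-1\ge m(n-1)$. Let $F$ be a field whose characteristic is either $0$ or greater than $(k-1)n-(m+1)\binom n2$. Let $A_1,\dots,A_n$ be subsets of $F$ with $|A_1|=\cdots=|A_n|=k$, and let $P_1(x),\dots,P_n(x)\in F[x]$ be polynomials of degree at most $m$ whose coefficients of $x^m$ are pairwise distinct. For an $n\times n$ matrix $(c_{ij})$ over $F$ write $\operatorname{per}(c_{ij})=\sum_{\sigma\in S_n}\prod_{i=1}^n c_{i,\sigma(i)}$ for its permanent (with the convention $c^0=1$ for every $c\in F$, including $0^0=1$). Then the restricted sumset $$C=\Big\{\sum_{i=1}^n a_i:\ a_1\in A_1,\dots,a_n\in A_n,\ a_i\ne a_j\text{ for }i\ne j,\ \text{and } \operatorname{per}\big(P_j(a_j)^{i-1}\big)_{1\le i,j\le n}\ne 0\Big\}$$ satisfies $$|C|\ \ge\ (k-1)n-(m+1)\binom n2+1\ >\ (m-1)\binom n2 .$$ -/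

import Mathlib

open MvPolynomial Equiv Matrix
open scoped Nat

/-! Combinatorial Nullstellensatz. Put d = k - 1, K = dn - (m+1) * choose(n, 2), and suppose |C| ≤
K. The product of the Vandermonde determinant in the x_j, the permanent, ∏_{c ∈ C} (∑ x_j - c) and a
power of ∑ x_j raising the degree to dn vanishes on ∏ A_j. Yet its coefficient at ∏ x_j^d is
nonzero. Only top forms matter there, so P_j may be replaced by b_j x_j^m. For each τ in the
permanent there remains an alternating sum over σ of multinomial coefficients, which is K! / ∏ y_j!
times a determinant of descending factorials of y_{τ j} = d - m τ(j). That is a Vandermonde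
determinant, so τ enters only through its sign (`exists_sum_sign_shiftedMultinomial_mul`). The sign
turns the permanent's expansion into the Vandermonde determinant of the distinct b_j. -/

/-- `q` is a form of degree `a`, and `p - q` has only monomials of degree less than `a`. -/
structure MvPolynomial.HasTopForm {ι R : Type*} [CommRing R] (a : ℕ) (p q : MvPolynomial ι R) :
    Prop where
  isHomogeneous : q.IsHomogeneous a
  coeff_eq : ∀ d : ι →₀ ℕ, a ≤ d.degree → coeff d p = coeff d q

namespace MvPolynomial.HasTopForm

variable {ι R : Type*} [CommRing R] {a b : ℕ} {p q p' q' : MvPolynomial ι R}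

theorem coeff_eq_zero (h : HasTopForm a p q) {d : ι →₀ ℕ} (hd : a < d.degree) :
    coeff d p = 0 := by
  rw [h.coeff_eq d hd.le]
  exact h.isHomogeneous.coeff_eq_zero hd.ne'

theorem totalDegree_le (h : HasTopForm a p q) : p.totalDegree ≤ a := by
  refine Finset.sup_le fun d hd => ?_
  by_contra! hlt
  exact mem_support_iff.mp hd (h.coeff_eq_zero hlt)

theorem of_isHomogeneous (h : p.IsHomogeneous a) : HasTopForm a p p := ⟨h, fun _ _ => rfl⟩

theorem mul (h : HasTopForm a p q) (h' : HasTopForm b p' q') :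
    HasTopForm (a + b) (p * p') (q * q') := by
  classical
  refine ⟨h.isHomogeneous.mul h'.isHomogeneous, fun d hd => ?_⟩
  rw [coeff_mul, coeff_mul]
  refine Finset.sum_congr rfl fun x hx => ?_
  have hx' : x.1.degree + x.2.degree = d.degree := by
    rw [← map_add, Finset.HasAntidiagonal.mem_antidiagonal.mp hx]
  rcases lt_or_ge a x.1.degree with h1 | h1
  · rw [h.coeff_eq_zero h1, h.isHomogeneous.coeff_eq_zero h1.ne', zero_mul, zero_mul]
  · rcases lt_or_ge b x.2.degree with h2 | h2
    · rw [h'.coeff_eq_zero h2, h'.isHomogeneous.coeff_eq_zero h2.ne', mul_zero, mul_zero]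
    · rw [h.coeff_eq _ (by omega), h'.coeff_eq _ (by omega)]

theorem one : HasTopForm 0 (1 : MvPolynomial ι R) 1 := of_isHomogeneous (isHomogeneous_one ι R)

theorem prod {κ : Type*} (s : Finset κ) {a : κ → ℕ} {p q : κ → MvPolynomial ι R}
    (h : ∀ i ∈ s, HasTopForm (a i) (p i) (q i)) :
    HasTopForm (∑ i ∈ s, a i) (∏ i ∈ s, p i) (∏ i ∈ s, q i) := by
  classical
  induction s using Finset.induction_on with
  | empty => simpa using one
  | insert i s hi ih =>
    rw [Finset.sum_insert hi, Finset.prod_insert hi, Finset.prod_insert hi]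
    exact (h i (Finset.mem_insert_self i s)).mul
      (ih fun j hj => h j (Finset.mem_insert_of_mem hj))

theorem pow (h : HasTopForm a p q) (n : ℕ) : HasTopForm (n * a) (p ^ n) (q ^ n) := by
  simpa using prod (Finset.range n) (fun _ _ => h)

theorem sum {κ : Type*} (s : Finset κ) {p q : κ → MvPolynomial ι R}
    (h : ∀ i ∈ s, HasTopForm a (p i) (q i)) :
    HasTopForm a (∑ i ∈ s, p i) (∑ i ∈ s, q i) := by
  refine ⟨IsHomogeneous.sum s q a fun i hi => (h i hi).isHomogeneous, fun d hd => ?_⟩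
  rw [coeff_sum, coeff_sum]
  exact Finset.sum_congr rfl fun i hi => (h i hi).coeff_eq d hd

theorem sub_C (h : HasTopForm a p q) (ha : 0 < a) (c : R) : HasTopForm a (p - C c) q := by
  classical
  refine ⟨h.isHomogeneous, fun d hd => ?_⟩
  have hd0 : d ≠ 0 := by
    rintro rfl
    simp at hd
    omega
  rw [coeff_sub, h.coeff_eq d hd, coeff_C, if_neg hd0.symm, sub_zero]

theorem aeval_X {m : ℕ} {P : Polynomial R} (hP : P.degree ≤ m) (i : ι) :
    HasTopForm m (Polynomial.aeval (X i : MvPolynomial ι R) P)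
      (monomial (.single i m) (P.coeff m)) := by
  classical
  refine ⟨isHomogeneous_monomial _ (by simp), fun d hd => ?_⟩
  have hP' : P.natDegree < m + 1 := Nat.lt_succ_of_le (Polynomial.natDegree_le_of_degree_le hP)
  rw [Polynomial.aeval_eq_sum_range' hP', coeff_sum, Finset.sum_range_succ,
    Finset.sum_eq_zero, zero_add]
  · simp [coeff_X_pow, coeff_monomial]
  · intro l hl
    rw [coeff_smul, coeff_X_pow, if_neg, smul_zero]
    rintro rfl
    simp at hl hd
    omega

end MvPolynomial.HasTopForm

/-! ### Factorials, Vandermonde determinants and alternating multinomial sums -/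

theorem Nat.pow_mul_factorial_dvd_factorial_mul {m : ℕ} (hm : 0 < m) (s : ℕ) :
    m ^ s * s ! ∣ (m * s)! := by
  induction s with
  | zero => simp
  | succ s ih =>
    obtain ⟨l, hl⟩ : ∃ l, m * (s + 1) = l + 1 := Nat.exists_eq_add_one.mpr (by positivity)
    have h1 : m * s ≤ l := by rw [mul_add] at hl; omega
    have : (m * (s + 1))! = m * (s + 1) * l ! := by rw [hl, Nat.factorial_succ]
    rw [this, Nat.factorial_succ, pow_succ]
    calc m ^ s * m * ((s + 1) * s !) = m * (s + 1) * (m ^ s * s !) := by ring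
      _ ∣ _ := mul_dvd_mul_left _ (ih.trans (Nat.factorial_dvd_factorial h1))

theorem Fin.prod_Iio_sub {n : ℕ} (j : Fin n) :
    ∏ i ∈ Finset.Iio j, ((j : ℤ) - (i : ℤ)) = ((j : ℕ)! : ℤ) := by
  have h : ∏ i ∈ Finset.Iio j, ((j : ℤ) - (i : ℤ)) =
      ∏ i ∈ (Finset.Iio j).map Fin.valEmbedding, ((j : ℤ) - (i : ℤ)) := by
    rw [Finset.prod_map]; rfl
  rw [h, Fin.map_valEmbedding_Iio, ← Nat.descFactorial_self, Nat.descFactorial_eq_prod_range,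
    Nat.Iio_eq_range, Nat.cast_prod]
  refine Finset.prod_congr rfl fun i hi => ?_
  rw [Nat.cast_sub (Finset.mem_range.mp hi).le]

theorem Matrix.det_vandermonde_arithmetic (n : ℕ) (a c : ℤ) :
    (vandermonde fun i : Fin n => a + c * ((i : ℕ) : ℤ)).det =
      ∏ j : Fin n, (c ^ (j : ℕ) * ((j : ℕ)! : ℤ)) := by
  rw [det_vandermonde, Finset.prod_comm' (t' := Finset.univ) (s' := fun j => Finset.Iio j)
    (by simp)]
  refine Finset.prod_congr rfl fun j _ => ?_
  rw [← Fin.prod_Iio_sub j, ← Fin.card_Iio j, ← Finset.prod_const, ← Finset.prod_mul_distrib]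
  exact Finset.prod_congr rfl fun i _ => by ring

/-- Descending factorials are monic of degree i in y, so unitriangular operations reduce them to
powers. -/
theorem Matrix.det_descFactorial {n : ℕ} (y : Fin n → ℕ) :
    (Matrix.of fun i j : Fin n => ((y j).descFactorial i : ℤ)).det =
      (vandermonde fun i => (y i : ℤ)).det := by
  rw [det_eval_matrixOfPolynomials_eq_det_vandermonde _ (fun i => descPochhammer ℤ i)
    (fun i => descPochhammer_natDegree ℤ i) (fun i => monic_descPochhammer ℤ i), ← det_transpose]
  congr 1
  ext i j
  simp [descPochhammer_eval_eq_descFactorial]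

/-- The coefficient of `∏ X_j ^ (y j)` in `(∏ X_j ^ (s j)) * (∑ X_j) ^ K`, provided the degrees
match. -/
def shiftedMultinomial {n : ℕ} (y s : Fin n → ℕ) : ℕ :=
  if ∀ i, s i ≤ y i then Nat.multinomial Finset.univ (y - s) else 0

/-- The value 0 outside the range matches the vanishing of descending factorials, so a determinant
can run over all permutations. -/
theorem shiftedMultinomial_mul_prod_factorial {n K : ℕ} {y s : Fin n → ℕ}
    (h : ∑ i, y i = K + ∑ i, s i) :
    shiftedMultinomial y s * ∏ i, (y i)! = K ! * ∏ i, (y i).descFactorial (s i) := by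
  unfold shiftedMultinomial
  split_ifs with hs
  · have hK : ∑ i, (y - s) i = K := by
      have : ∑ i, (y - s) i + ∑ i, s i = ∑ i, y i := by
        rw [← Finset.sum_add_distrib]
        exact Finset.sum_congr rfl fun i _ => Nat.sub_add_cancel (hs i)
      omega
    have hy : ∏ i, (y i)! = (∏ i, ((y - s) i)!) * ∏ i, (y i).descFactorial (s i) := by
      rw [← Finset.prod_mul_distrib]
      exact Finset.prod_congr rfl fun i _ => (Nat.factorial_mul_descFactorial (hs i)).symm
    rw [hy, ← hK, ← Nat.multinomial_spec]
    ring
  · obtain ⟨i, hi⟩ : ∃ i, y i < s i := by simpa using hs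
    rw [Finset.prod_eq_zero (f := fun i => (y i).descFactorial (s i)) (Finset.mem_univ i)
      (Nat.descFactorial_eq_zero_iff_lt.mpr hi)]
    simp

theorem Fin.sum_val_eq_choose (n : ℕ) : ∑ i : Fin n, (i : ℕ) = n.choose 2 := by
  rw [Fin.sum_univ_eq_sum_range (fun i => i), Finset.sum_range_id, Nat.choose_two_right]

/-- An alternating sum of multinomial coefficients, up to a factor that does not depend on `τ`. -/
theorem exists_sum_sign_shiftedMultinomial_mul {n m d K : ℕ} (hm : 0 < m) (hd : m * (n - 1) ≤ d)
    (hK : K + (m + 1) * n.choose 2 = d * n) :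
    ∃ (Q : ℤ) (u : ℤˣ), ∀ τ : Perm (Fin n),
      (∑ σ : Perm (Fin n), (Perm.sign σ : ℤ) *
        (shiftedMultinomial (fun j => d - m * (τ j : ℕ)) (fun j => (σ j : ℕ)) : ℤ)) * Q =
        K ! * (Perm.sign τ : ℤ) * (u : ℤ) := by
  set y : Fin n → ℕ := fun i => d - m * (i : ℕ) with hy
  have hmy (i : Fin n) : m * (i : ℕ) ≤ d := (Nat.mul_le_mul_left m (by omega)).trans hd
  -- Reversing the index pairs m^j j! with y = d - m(n-1-j) ≥ mj. Cancelling this product over ℤ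
  -- leaves K! as the only factorial that must be nonzero in F.
  have hdvd : (∏ j : Fin n, (m ^ (j : ℕ) * (j : ℕ)!)) ∣ ∏ j, (y j)! := by
    rw [← Equiv.prod_comp Fin.revPerm fun j => (y j)!]
    refine Finset.prod_dvd_prod_of_dvd _ _ fun j _ => ?_
    refine (Nat.pow_mul_factorial_dvd_factorial_mul hm j).trans (Nat.factorial_dvd_factorial ?_)
    simp only [hy, Fin.revPerm_apply, Fin.val_rev]
    have : m * (j : ℕ) + m * (n - (j + 1)) = m * (n - 1) := by
      rw [← mul_add]; congr 1; omega
    omega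
  obtain ⟨Q, hQ⟩ := hdvd
  refine ⟨Q, ∏ j : Fin n, (-1) ^ (j : ℕ), fun τ => ?_⟩
  have hsum (σ : Perm (Fin n)) : ∑ j, y (τ j) = K + ∑ j, (σ j : ℕ) := by
    rw [Equiv.sum_comp τ y, Equiv.sum_comp σ (fun i : Fin n => (i : ℕ)), Fin.sum_val_eq_choose]
    have h1 : ∑ i : Fin n, y i + m * ∑ i : Fin n, (i : ℕ) = d * n := by
      rw [Finset.mul_sum, ← Finset.sum_add_distrib,
        Finset.sum_congr rfl fun i _ => Nat.sub_add_cancel (hmy i)]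
      simp [mul_comm]
    rw [Fin.sum_val_eq_choose] at h1
    linarith
  have hN : (∑ σ : Perm (Fin n), (Perm.sign σ : ℤ) *
        (shiftedMultinomial (y ∘ τ) (fun j => (σ j : ℕ)) : ℤ)) * (∏ j, (y j)! : ℕ) =
        K ! * ((Perm.sign τ : ℤ) * ∏ j : Fin n, ((-m : ℤ) ^ (j : ℕ) * ((j : ℕ)! : ℤ))) := by
    have hv : (fun i : Fin n => (y i : ℤ)) = fun i : Fin n => (d : ℤ) + (-m) * ((i : ℕ) : ℤ) := by
      ext i
      simp only [hy]
      rw [Nat.cast_sub (hmy i)]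
      push_cast
      ring
    have hperm := det_permute' τ (Matrix.of fun i j : Fin n => ((y j).descFactorial i : ℤ))
    rw [det_apply'] at hperm
    simp only [Int.cast_id] at hperm
    rw [← det_vandermonde_arithmetic n d (-m), ← hv, ← det_descFactorial, ← hperm,
      Finset.sum_mul, Finset.mul_sum]
    refine Finset.sum_congr rfl fun σ _ => ?_
    have := shiftedMultinomial_mul_prod_factorial (y := y ∘ τ) (hsum σ)
    simp only [Function.comp_def] at this ⊢
    rw [Equiv.prod_comp τ fun j => (y j)!] at this
    rw [mul_assoc, ← Nat.cast_mul, this]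
    simp
    ring
  rw [hQ] at hN
  have hne : (∏ j : Fin n, ((m : ℤ) ^ (j : ℕ) * ((j : ℕ)! : ℤ))) ≠ 0 :=
    Finset.prod_ne_zero_iff.mpr fun j _ => by positivity
  have hneg : ∏ j : Fin n, ((-m : ℤ) ^ (j : ℕ) * ((j : ℕ)! : ℤ)) =
      (((∏ j : Fin n, (-1) ^ (j : ℕ) : ℤˣ)) : ℤ) *
        ∏ j : Fin n, ((m : ℤ) ^ (j : ℕ) * ((j : ℕ)! : ℤ)) := by
    rw [Units.coe_prod, ← Finset.prod_mul_distrib]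
    refine Finset.prod_congr rfl fun j _ => ?_
    rw [neg_pow]
    push_cast
    ring
  rw [hneg] at hN
  apply mul_right_cancel₀ hne
  push_cast at hN ⊢
  simp only [Function.comp_def, hy] at hN
  linear_combination hN

theorem MvPolynomial.coeff_monomial_mul_sum_X_pow {R : Type*} [CommRing R] {n d m K : ℕ}
    (hd : m * (n - 1) ≤ d) (hK : K + (m + 1) * n.choose 2 = d * n) (σ τ : Perm (Fin n)) (r : R) :
    coeff (Finsupp.equivFunOnFinite.symm fun _ : Fin n => d)
      (monomial (Finsupp.equivFunOnFinite.symm fun j => (σ j : ℕ) + m * (τ j : ℕ)) r *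
        (∑ j, X j) ^ K) =
      r * (shiftedMultinomial (fun j => d - m * (τ j : ℕ)) (fun j => (σ j : ℕ)) : R) := by
  have hmy (i : Fin n) : m * (i : ℕ) ≤ d := (Nat.mul_le_mul_left m (by omega)).trans hd
  have hiff : (Finsupp.equivFunOnFinite.symm fun j => (σ j : ℕ) + m * (τ j : ℕ)) ≤
      (Finsupp.equivFunOnFinite.symm fun _ : Fin n => d) ↔
      ∀ j, (σ j : ℕ) ≤ d - m * (τ j : ℕ) := by
    simp only [Finsupp.le_def, Finsupp.equivFunOnFinite_symm_apply_apply]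
    exact forall_congr' fun j => by have := hmy (τ j); omega
  rw [coeff_monomial_mul', shiftedMultinomial]
  by_cases h : ∀ j, (σ j : ℕ) ≤ d - m * (τ j : ℕ)
  · rw [if_pos (hiff.mpr h), if_pos h, coeff_sum_X_pow_of_fintype, if_pos,
      ← Finsupp.multinomial_of_support_subset (Finset.subset_univ _)]
    · congr 3
      ext j
      simp
      omega
    · rw [Finsupp.sum_fintype _ _ (by simp)]
      have : ∑ j : Fin n, (d - ((σ j : ℕ) + m * (τ j : ℕ))) + (∑ j, (σ j : ℕ) + m * ∑ j, (τ j : ℕ))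
          = d * n := by
        rw [Finset.mul_sum, ← Finset.sum_add_distrib, ← Finset.sum_add_distrib,
          Finset.sum_congr rfl fun j _ => Nat.sub_add_cancel
            (by have := h j; have := hmy (τ j); omega)]
        simp [mul_comm]
      rw [Equiv.sum_comp σ (fun i : Fin n => (i : ℕ)), Equiv.sum_comp τ (fun i : Fin n => (i : ℕ)),
        Fin.sum_val_eq_choose] at this
      simp
      linarith
  · rw [if_neg (mt hiff.mp h), if_neg h]
    simp

/-! ### The polynomial detecting admissible tuples -/

/-- The Vandermonde determinant of the variables times the permanent of the matrix of powers
of the `P j (X j)`. -/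
noncomputable def vandermondePermanent {F : Type*} [CommRing F] {n : ℕ}
    (P : Fin n → Polynomial F) : MvPolynomial (Fin n) F :=
  (vandermonde (X : Fin n → MvPolynomial (Fin n) F)).det *
    (Matrix.of fun i j : Fin n =>
      (Polynomial.aeval (X j : MvPolynomial (Fin n) F) (P j)) ^ (i : ℕ)).permanent

theorem eval_vandermondePermanent {F : Type*} [CommRing F] {n : ℕ} (P : Fin n → Polynomial F)
    (a : Fin n → F) :
    eval a (vandermondePermanent P) = (vandermonde a).det *
      (Matrix.of fun i j : Fin n => (P j).eval (a j) ^ (i : ℕ)).permanent := by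
  have (j : Fin n) : eval a (Polynomial.aeval (X j : MvPolynomial (Fin n) F) (P j)) =
      (P j).eval (a j) := by
    rw [Polynomial.aeval_def, Polynomial.hom_eval₂]
    have : (eval a).comp C = RingHom.id F := by ext; simp
    simp [MvPolynomial.algebraMap_eq, this]
  simp [vandermondePermanent, det_vandermonde, permanent, this]

/-- `HasTopForm` allows a zero form, so possible cancellation is harmless here. -/
theorem vandermondePermanent_hasTopForm {F : Type*} [CommRing F] {n m : ℕ}
    {P : Fin n → Polynomial F} (hdeg : ∀ i, (P i).degree ≤ m) :
    HasTopForm ((m + 1) * n.choose 2) (vandermondePermanent P)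
      (∑ τ : Perm (Fin n), ∑ σ : Perm (Fin n),
        monomial (Finsupp.equivFunOnFinite.symm fun j => (σ j : ℕ) + m * (τ j : ℕ))
          ((Perm.sign σ : ℤ) * ∏ j, (P j).coeff m ^ (τ j : ℕ) : F)) := by
  have h : vandermondePermanent P = ∑ τ : Perm (Fin n), ∑ σ : Perm (Fin n),
      (∏ j, X j ^ (σ j : ℕ)) * C ((Perm.sign σ : ℤ) : F) *
        ∏ j, (Polynomial.aeval (X j : MvPolynomial (Fin n) F) (P j)) ^ (τ j : ℕ) := by
    rw [vandermondePermanent, ← det_transpose, det_apply', permanent, Finset.sum_mul_sum,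
      Finset.sum_comm]
    simp [mul_comm]
  rw [h]
  refine HasTopForm.sum _ fun τ _ => HasTopForm.sum _ fun σ _ => ?_
  have h1 : HasTopForm (n.choose 2) ((∏ j, X j ^ (σ j : ℕ)) * C ((Perm.sign σ : ℤ) : F))
      (monomial (Finsupp.equivFunOnFinite.symm fun j => (σ j : ℕ)) ((Perm.sign σ : ℤ) : F)) := by
    have : (∏ j, X j ^ (σ j : ℕ)) * C ((Perm.sign σ : ℤ) : F) =
        monomial (Finsupp.equivFunOnFinite.symm fun j => (σ j : ℕ)) ((Perm.sign σ : ℤ) : F) := by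
      rw [monomial_eq, mul_comm, Finsupp.prod_fintype _ _ (by simp)]
      simp
    rw [this]
    refine HasTopForm.of_isHomogeneous (isHomogeneous_monomial _ ?_)
    rw [Finsupp.degree_eq_sum]
    simp [Equiv.sum_comp σ (fun i : Fin n => (i : ℕ)), Fin.sum_val_eq_choose]
  have h2 := HasTopForm.prod Finset.univ
    fun j _ => (HasTopForm.aeval_X (ι := Fin n) (hdeg j) j).pow (τ j : ℕ)
  convert h1.mul h2 using 1
  · rw [← Finset.sum_mul, Equiv.sum_comp τ (fun i : Fin n => (i : ℕ)), Fin.sum_val_eq_choose]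
    ring
  · simp_rw [monomial_pow]
    rw [← monomial_sum_prod, monomial_mul]
    refine congrArg₂ (fun s r => monomial s r) ?_ rfl
    ext j
    simp [Finsupp.single_apply, mul_comm]

/-! ### The Nullstellensatz argument -/

theorem lt_ncard_restricted_sumset {F : Type*} [Field F] {n m d K : ℕ} (hm : 0 < m)
    (hd : m * (n - 1) ≤ d) (hK : K + (m + 1) * n.choose 2 = d * n) (hF : (K ! : F) ≠ 0)
    (A : Fin n → Finset F) (hA : ∀ i, d < (A i).card)
    (P : Fin n → Polynomial F) (hdeg : ∀ i, (P i).degree ≤ m)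
    (hcoeff : Function.Injective fun i => (P i).coeff m) :
    K < {c : F | ∃ a : Fin n → F, (∀ i, a i ∈ A i) ∧ (∀ i j, i ≠ j → a i ≠ a j) ∧
          (Matrix.of fun i j : Fin n => (P j).eval (a j) ^ (i : ℕ)).permanent ≠ 0 ∧
          c = ∑ i, a i}.ncard := by
  classical
  set S := {c : F | ∃ a : Fin n → F, (∀ i, a i ∈ A i) ∧ (∀ i j, i ≠ j → a i ≠ a j) ∧
          (Matrix.of fun i j : Fin n => (P j).eval (a j) ^ (i : ℕ)).permanent ≠ 0 ∧
          c = ∑ i, a i} with hS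
  have hfin : S.Finite := by
    refine ((Fintype.piFinset A).finite_toSet.image fun a => ∑ i, a i).subset ?_
    rintro c ⟨a, ha, -, -, rfl⟩
    exact ⟨a, by simpa using ha, rfl⟩
  by_contra! hle
  rw [Set.ncard_eq_toFinset_card S hfin] at hle
  set T := hfin.toFinset with hT
  have hlin : HasTopForm 1 (∑ j, X j : MvPolynomial (Fin n) F) (∑ j, X j) :=
    HasTopForm.of_isHomogeneous (IsHomogeneous.sum _ _ _ fun j _ => isHomogeneous_X F j)
  have htop := (vandermondePermanent_hasTopForm hdeg).mul
    ((hlin.pow (K - T.card)).mul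
      (HasTopForm.prod T fun c _ => hlin.sub_C one_pos c))
  have hdegsum : (m + 1) * n.choose 2 + ((K - T.card) * 1 + ∑ c ∈ T, 1) = d * n := by
    simp
    omega
  rw [hdegsum, Finset.prod_const, ← pow_add, Nat.sub_add_cancel hle] at htop
  set t : Fin n →₀ ℕ := Finsupp.equivFunOnFinite.symm fun _ => d with ht
  have htdeg : t.degree = d * n := by
    rw [Finsupp.degree_eq_sum]
    simp [ht, mul_comm]
  obtain ⟨Q, u, hQ⟩ := exists_sum_sign_shiftedMultinomial_mul hm hd hK
  have hne : coeff t (vandermondePermanent P *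
      ((∑ j, X j) ^ (K - T.card) * ∏ c ∈ T, (∑ j, X j - C c))) ≠ 0 := by
    rw [htop.coeff_eq t htdeg.ge, Finset.sum_mul, coeff_sum]
    simp_rw [ht, Finset.sum_mul, coeff_sum, coeff_monomial_mul_sum_X_pow hd hK]
    -- The multiple by Q is explicit; its being nonzero suffices, with no separate check of Q in F.
    refine left_ne_zero_of_mul (b := (Q : F)) ?_
    have : (∑ τ : Perm (Fin n), ∑ σ : Perm (Fin n),
        ((Perm.sign σ : ℤ) * ∏ j, (P j).coeff m ^ (τ j : ℕ) : F) *
        (shiftedMultinomial (fun j => d - m * (τ j : ℕ)) (fun j => (σ j : ℕ)) : F)) * (Q : F) =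
        (K ! : F) * ((u : ℤ) : F) * (vandermonde fun i => (P i).coeff m).det := by
      rw [← det_transpose, det_apply', Finset.sum_mul, Finset.mul_sum]
      refine Finset.sum_congr rfl fun τ _ => ?_
      have := congrArg (Int.cast : ℤ → F) (hQ τ)
      push_cast at this
      simp only [transpose_apply, vandermonde_apply]
      simp_rw [mul_right_comm _ (∏ j, (P j).coeff m ^ (τ j : ℕ))]
      rw [← Finset.sum_mul]
      linear_combination (∏ j, (P j).coeff m ^ (τ j : ℕ)) * this
    rw [this]
    refine mul_ne_zero (mul_ne_zero hF ?_) (det_vandermonde_ne_zero_iff.mpr hcoeff)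
    rcases Int.units_eq_one_or u with rfl | rfl <;> simp
  have htotal := le_antisymm htop.totalDegree_le
    (htdeg ▸ le_totalDegree (mem_support_iff.mpr hne))
  obtain ⟨a, haA, ha⟩ := combinatorial_nullstellensatz_exists_eval_nonzero _ t hne
    (htotal.trans htdeg.symm) A (fun i => by simpa [ht] using hA i)
  rw [map_mul, map_mul, eval_vandermondePermanent] at ha
  have h1 := left_ne_zero_of_mul ha
  have hinj := det_vandermonde_ne_zero_iff.mp (left_ne_zero_of_mul h1)
  have h2 := right_ne_zero_of_mul (right_ne_zero_of_mul ha)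
  have hmem : ∑ i, a i ∈ T := by
    rw [hT, hfin.mem_toFinset]
    exact ⟨a, haA, fun i j hij => hinj.ne hij, right_ne_zero_of_mul h1, rfl⟩
  apply h2
  rw [map_prod]
  exact Finset.prod_eq_zero hmem (by simp)

theorem natCast_factorial_ne_zero_of_lt_ringChar {F : Type*} [Field F] {K : ℕ}
    (h : ringChar F = 0 ∨ K < ringChar F) : (K ! : F) ≠ 0 := by
  rw [Ne, ringChar.spec]
  rcases h with h | h
  · rw [h, zero_dvd_iff]
    exact K.factorial_ne_zero
  · have hp : (ringChar F).Prime :=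
      (CharP.char_is_prime_or_zero F (ringChar F)).resolve_right (by omega)
    rw [hp.dvd_factorial]
    omega

theorem theorem5p1 {F : Type*} [Field F] (n k m : ℕ) (hm : 0 < m)
    (A : Fin n → Finset F) (hA : ∀ i, (A i).card = k)
    (P : Fin n → Polynomial F) (hdeg : ∀ i, (P i).degree ≤ (m : WithBot ℕ))
    (hcoeff : ∀ i j, i ≠ j → (P i).coeff m ≠ (P j).coeff m)
    (hk : (m : ℤ) * ((n : ℤ) - 1) ≤ (k : ℤ) - 1)
    (hchar : ringChar F = 0 ∨
      ((k : ℤ) - 1) * n - ((m : ℤ) + 1) * (n.choose 2 : ℤ) < (ringChar F : ℤ)) :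
    ((k : ℤ) - 1) * n - ((m : ℤ) + 1) * (n.choose 2 : ℤ) + 1 ≤
      (({c : F | ∃ a : Fin n → F, (∀ i, a i ∈ A i) ∧ (∀ i j, i ≠ j → a i ≠ a j) ∧
          (Matrix.of fun i j : Fin n => (P j).eval (a j) ^ (i : ℕ)).permanent ≠ 0 ∧
          c = ∑ i, a i}.ncard : ℕ) : ℤ) ∧
    ((m : ℤ) - 1) * (n.choose 2 : ℤ) <
      ((k : ℤ) - 1) * n - ((m : ℤ) + 1) * (n.choose 2 : ℤ) + 1 := by
  have hchoose : (2 : ℤ) * (n.choose 2 : ℤ) = n * ((n : ℤ) - 1) := by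
    rw [← Fin.sum_val_eq_choose, Fin.sum_univ_eq_sum_range (fun i => i)]
    have := Finset.sum_range_id_mul_two n
    cases n with
    | zero => simp
    | succ n =>
      push_cast
      zify at this
      simp at this
      linarith
  have hmain : ((m : ℤ) - 1) * (n.choose 2 : ℤ) ≤
      ((k : ℤ) - 1) * n - ((m : ℤ) + 1) * (n.choose 2 : ℤ) := by
    have := mul_le_mul_of_nonneg_right hk (Int.natCast_nonneg n)
    linear_combination this + (m : ℤ) * hchoose
  refine ⟨?_, by omega⟩
  have hm1 : (0 : ℤ) ≤ (m : ℤ) - 1 := by omega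
  obtain ⟨K, hK⟩ := Int.eq_ofNat_of_zero_le
    ((mul_nonneg hm1 (Int.natCast_nonneg (n.choose 2))).trans hmain)
  -- Truncated k - 1 is harmless: k = 0 is possible only when n = 0.
  have hkn : ((k - 1 : ℕ) : ℤ) * n = ((k : ℤ) - 1) * n := by
    rcases Nat.eq_zero_or_pos n with rfl | hn
    · simp
    · have : (0 : ℤ) ≤ (m : ℤ) * ((n : ℤ) - 1) := mul_nonneg (by omega) (by omega)
      rw [Nat.cast_sub (by omega)]
      simp
  have hkpos (hn : 0 < n) : 0 < k := by
    have : (0 : ℤ) ≤ (m : ℤ) * ((n : ℤ) - 1) := mul_nonneg (by omega) (by omega)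
    omega
  have hd : m * (n - 1) ≤ k - 1 := by
    rcases Nat.eq_zero_or_pos n with rfl | hn
    · simp
    · zify [hn, hkpos hn]
      exact hk
  rw [hK]
  rw [hK] at hchar
  have := lt_ncard_restricted_sumset (K := K) hm hd (by zify; linarith)
    (natCast_factorial_ne_zero_of_lt_ringChar (hchar.imp_right fun h => by exact_mod_cast h)) A
    (fun i => by rw [hA i]; have := hkpos i.pos; omega) P hdeg
    (fun i j hij => by by_contra h; exact hcoeff i j h hij)
  exact_mod_cast this
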